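/- Let $X$ be a metric space. For an integer $m\ge 0$, write $\dim_{NA}(X)\le m$ ($X$ has Nagata--Assouad dimension at most $m$) if there is a constant $C>0$ such that for every $r>0$ there is a cover $\mathcal U=\bigcup_{i=1}^{m+1}\mathcal U_i$ of $X$ such that each family $\mathcal U_i$ is $r$-disjoint (that is, $d(x,y)\ge r$ whenever $x\in U$, $y\in V$ for distinct $U,V\in\mathcal U_i$) and every element of $\mathcal U$ has diameter at most $C\cdot r$. A metric space $E$ is a Lipschitz extensor of $X$ if there is a constant $C>0$ such that for every $\lambda\ge 0$ and every subset $A\subseteq X$, any $\lambda$-Lipschitz map $f:A\to E$ extends to a $C\lambda$-Lipschitz map $\tilde f:X\to E$. Let $$S^n=\partial\Delta^{n+1}=\Big\{x\in\mathbb R^{n+2} : x_i\ge 0 \text{ for all } i,\ \sum_i x_i=1,\ x_i=0\text{ for some } i\Big\}$$ be the boundary of the standard $(n+1)$-simplex, with the metric induced by either the $\ell_1$ norm or the $\ell_2$ norm of $\mathbb R^{n+2}$. Theorem. Suppose that $X$ has finite Nagata--Assouad dimension, i.e. $\dim_{NA}(X)\le m$ for some integer $m\ge 0$, and let $n\ge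 0$ be an integer. Then $S^n$ is a Lipschitz extensor of $X$ if and only if $\dim_{NA}(X)\le n$. -/

import Mathlib

open scoped NNReal ENNReal

/-- A family `𝒰` of subsets of a metric space is `r`-disjoint if points lying in two different
members of `𝒰` are at distance at least `r`. -/
def RDisjoint {X : Type*} [MetricSpace X] (r : ℝ) (𝒰 : Set (Set X)) : Prop :=
  ∀ U ∈ 𝒰, ∀ V ∈ 𝒰, U ≠ V → ∀ x ∈ U, ∀ y ∈ V, r ≤ dist x y

/-- `X` has Nagata–Assouad dimension at most `n`: there is `C > 0` such that for every `r > 0`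
there are `n + 1` families of subsets of `X`, each of them `r`-disjoint, which together cover `X`
and whose members all have diameter at most `C * r`. -/
def NagataDimLE (X : Type*) [MetricSpace X] (n : ℕ) : Prop :=
  ∃ C : ℝ, 0 < C ∧ ∀ r : ℝ, 0 < r →
    ∃ 𝒰 : Fin (n + 1) → Set (Set X),
      (∀ x : X, ∃ i, ∃ U ∈ 𝒰 i, x ∈ U) ∧
      (∀ i, RDisjoint r (𝒰 i)) ∧
      (∀ i, ∀ U ∈ 𝒰 i, ∀ x ∈ U, ∀ y ∈ U, dist x y ≤ C * r)

/-- `E` is a Lipschitz extensor of `X`: there is `C > 0` such that every `K`-Lipschitz map from a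
subset of `X` to `E` extends to a `(C * K)`-Lipschitz map from `X` to `E`. -/
def IsLipschitzExtensor (E X : Type*) [MetricSpace E] [MetricSpace X] : Prop :=
  ∃ C : ℝ≥0, 0 < C ∧ ∀ (K : ℝ≥0) (A : Set X) (f : A → E), LipschitzWith K f →
    ∃ g : X → E, LipschitzWith (C * K) g ∧ ∀ a : A, g a = f a

/-- The `n`-sphere `∂Δ^{n+1}`: the boundary of the standard `(n+1)`-simplex, consisting of the
points of the simplex that have a vanishing barycentric coordinate, as a subset of `ℝ^{n+2}` with
the `ℓ_p` norm (whose metric it carries). -/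
def simplexSphere (p : ℝ≥0∞) (n : ℕ) : Set (PiLp p (fun _ : Fin (n + 2) => ℝ)) :=
  {x | x.ofLp ∈ stdSimplex ℝ (Fin (n + 2)) ∧ ∃ i, x i = 0}

/-! ### Elementary Lipschitz estimates for products, quotients and interpolation. -/

section RealInequalities

/-! All norms on `ℝ^{n+2}` being comparable, the sphere may be treated coordinatewise, as the
boundary of a simplex (`isLipschitzExtensor_simplexSphere_iff`).

If the dimension is at most `n` (`NagataDimLE.boundaryExtensor`), a `K`-Lipschitz map into the
boundary extends to a map `F` into the full simplex. A partition of unity with `n + 1` members at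
scale comparable to `1 / K` approximates `F` by convex combinations of `n + 1` points from a fixed
finite net. A center `q` off the spans of all such `(n + 1)`-tuples is missed by a definite margin.
Using the approximation where `F` is near `q` and `F` near the boundary, radial projection from `q`
gives the extension. The function `minRatio q`, equal to 0 on the boundary and 1 exactly at `q`,
measures the margin.

Conversely, let the dimension be at most `n + 1`. A partition of unity maps `X` to the `(n +
1)`-simplex; extending its restriction to the preimage of the boundary pushes the map off the
interior without enlarging supports. Sorting points by which coordinates are large then gives `n +
1` families (`NagataDimLE.of_succ_of_boundaryExtensor`). Higher dimensions descend one at a time,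
since the extensor property passes to suspensions (`BoundaryExtensor.succ`). -/

lemma abs_mul_sub_mul_le_of_abs_le_one {u v u' v' : ℝ} (hu : |u| ≤ 1) (hv' : |v'| ≤ 1) :
    |u * v - u' * v'| ≤ |u - u'| + |v - v'| := by
  have h : u * v - u' * v' = u * (v - v') + (u - u') * v' := by ring
  rw [h]
  refine (abs_add_le _ _).trans ?_
  rw [abs_mul, abs_mul]
  nlinarith [abs_nonneg (v - v'), abs_nonneg (u - u')]

/-- Since `a' / b' ≤ 1`, an error in the denominator costs no more than one in the numerator, and
only `b` needs a quantitative lower bound. -/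
lemma abs_div_sub_div_le {a b a' b' ε : ℝ} (hε : 0 < ε) (hb : ε ≤ b) (hb' : 0 < b')
    (ha' : 0 ≤ a') (hab' : a' ≤ b') :
    |a / b - a' / b'| ≤ (|a - a'| + |b - b'|) / ε := by
  have hb0 : 0 < b := hε.trans_le hb
  have h : a / b - a' / b' = ((a - a') - a' / b' * (b - b')) / b := by
    field_simp; ring
  have h0 : 0 ≤ a' / b' := by positivity
  have h1 : a' / b' ≤ 1 := (div_le_one hb').2 hab'
  rw [h, abs_div, abs_of_pos hb0]
  refine div_le_div₀ (by positivity) ?_ hε hb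
  refine (abs_sub _ _).trans ?_
  rw [abs_mul, abs_of_nonneg h0]
  nlinarith [abs_nonneg (b - b')]

lemma abs_lineMap_sub_lineMap_le {t t' u v u' v' : ℝ} (ht : 0 ≤ t) (ht1 : t ≤ 1)
    (hu' : |u'| ≤ 1) (hv' : |v'| ≤ 1) :
    |((1 - t) * u + t * v) - ((1 - t') * u' + t' * v')|
      ≤ 2 * |t - t'| + |u - u'| + |v - v'| := by
  have h1 := abs_mul_sub_mul_le_of_abs_le_one (u := 1 - t) (v := u) (u' := 1 - t') (v' := u')
    (by rw [abs_le]; constructor <;> linarith) hu'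
  have h2 := abs_mul_sub_mul_le_of_abs_le_one (u := t) (v := v) (u' := t') (v' := v')
    (by rw [abs_le]; constructor <;> linarith) hv'
  have h3 : |1 - t - (1 - t')| = |t - t'| := by rw [abs_sub_comm]; congr 1; ring
  rw [h3] at h1
  have h4 := abs_add_le ((1 - t) * u - (1 - t') * u') (t * v - t' * v')
  have h5 : ((1 - t) * u + t * v) - ((1 - t') * u' + t' * v')
    = ((1 - t) * u - (1 - t') * u') + (t * v - t' * v') := by ring
  rw [h5]; linarith

/-- Truncation of a real number to the interval `[0, 1]`. -/
noncomputable def unitClamp (t : ℝ) : ℝ := max 0 (min 1 t)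

lemma unitClamp_nonneg (t : ℝ) : 0 ≤ unitClamp t := le_max_left _ _

lemma unitClamp_le_one (t : ℝ) : unitClamp t ≤ 1 := max_le zero_le_one (min_le_left _ _)

lemma unitClamp_of_nonpos {t : ℝ} (h : t ≤ 0) : unitClamp t = 0 :=
  max_eq_left ((min_le_right _ _).trans h)

lemma unitClamp_of_one_le {t : ℝ} (h : 1 ≤ t) : unitClamp t = 1 := by
  simp [unitClamp, min_eq_left h]

lemma abs_unitClamp_sub_le (s t : ℝ) : |unitClamp s - unitClamp t| ≤ |s - t| := by
  refine (abs_max_sub_max_le_max 0 (min 1 s) 0 (min 1 t)).trans ?_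
  refine max_le (by simp) ((abs_min_sub_min_le_max 1 s 1 t).trans (max_le (by simp) le_rfl))

end RealInequalities

/-! ### Depth inside the simplex and radial projection. -/

section MinRatio

variable {ι : Type*} [Fintype ι]

/-- The points of the standard simplex having a vanishing coordinate. -/
def simplexBoundary (ι : Type*) [Fintype ι] : Set (ι → ℝ) :=
  {x | x ∈ stdSimplex ℝ ι ∧ ∃ i, x i = 0}

/-- The least ratio `y i / q i`. -/
noncomputable def minRatio (q y : ι → ℝ) : ℝ := ⨅ i, y i / q i

/-- Radial projection away from `q` onto the boundary of the standard simplex. -/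
noncomputable def radialProj (q y : ι → ℝ) (i : ι) : ℝ :=
  (y i - minRatio q y * q i) / (1 - minRatio q y)

lemma apply_le_one_of_mem_stdSimplex {y : ι → ℝ} (hy : y ∈ stdSimplex ℝ ι) (i : ι) : y i ≤ 1 := by
  rw [← hy.2]
  exact Finset.single_le_sum (fun j _ => hy.1 j) (Finset.mem_univ i)

lemma abs_apply_le_one_of_mem_stdSimplex {y : ι → ℝ} (hy : y ∈ stdSimplex ℝ ι) (i : ι) :
    |y i| ≤ 1 := by
  rw [abs_of_nonneg (hy.1 i)]; exact apply_le_one_of_mem_stdSimplex hy i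

lemma abs_apply_sub_le_one {y z : ι → ℝ} (hy : y ∈ stdSimplex ℝ ι) (hz : z ∈ stdSimplex ℝ ι)
    (i : ι) : |y i - z i| ≤ 1 := by
  rw [abs_le]
  constructor <;> linarith [hy.1 i, hz.1 i, apply_le_one_of_mem_stdSimplex hy i,
    apply_le_one_of_mem_stdSimplex hz i]

lemma minRatio_le (q y : ι → ℝ) (i : ι) : minRatio q y ≤ y i / q i :=
  ciInf_le (Set.finite_range _).bddBelow i

lemma minRatio_mul_le {q : ι → ℝ} (hq : ∀ i, 0 < q i) (y : ι → ℝ) (i : ι) :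
    minRatio q y * q i ≤ y i :=
  (le_div_iff₀ (hq i)).1 (minRatio_le q y i)

variable [Nonempty ι]

lemma exists_eq_minRatio_mul {q : ι → ℝ} (hq : ∀ i, 0 < q i) (y : ι → ℝ) :
    ∃ i, y i = minRatio q y * q i := by
  obtain ⟨i, hi⟩ := exists_eq_ciInf_of_finite (f := fun i => y i / q i)
  exact ⟨i, by rw [minRatio, ← hi, div_mul_cancel₀ _ (hq i).ne']⟩

lemma minRatio_nonneg {q y : ι → ℝ} (hq : ∀ i, 0 < q i) (hy : ∀ i, 0 ≤ y i) :
    0 ≤ minRatio q y :=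
  le_ciInf fun i => div_nonneg (hy i) (hq i).le

lemma minRatio_eq_of_le {q y : ι → ℝ} (hq : ∀ i, 0 < q i) {a : ℝ} (h : ∀ i, a * q i ≤ y i)
    (i : ι) (hi : y i = a * q i) : minRatio q y = a := by
  apply le_antisymm
  · refine (minRatio_le q y i).trans ?_
    rw [hi, mul_div_cancel_right₀ _ (hq i).ne']
  · exact le_ciInf fun j => (le_div_iff₀ (hq j)).2 (h j)

lemma minRatio_eq_zero {q y : ι → ℝ} (hq : ∀ i, 0 < q i) (hy : y ∈ simplexBoundary ι) :
    minRatio q y = 0 := by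
  obtain ⟨i, hi⟩ := hy.2
  exact minRatio_eq_of_le hq (fun j => by simpa using hy.1.1 j) i (by simpa using hi)

lemma minRatio_add_mul {q : ι → ℝ} (hq : ∀ i, 0 < q i) (y : ι → ℝ) (a : ℝ) :
    minRatio q (fun i => y i + a * q i) = minRatio q y + a := by
  obtain ⟨i, hi⟩ := exists_eq_minRatio_mul hq y
  refine minRatio_eq_of_le hq (fun j => ?_) i ?_
  · linarith [minRatio_mul_le hq y j]
  · simp only [add_mul]; linarith

lemma minRatio_le_one {q y : ι → ℝ} (hq : ∀ i, 0 < q i) (hq1 : ∑ i, q i = 1)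
    (hy : y ∈ stdSimplex ℝ ι) : minRatio q y ≤ 1 := by
  rw [← hy.2]
  calc minRatio q y = ∑ i, minRatio q y * q i := by rw [← Finset.mul_sum, hq1, mul_one]
    _ ≤ ∑ i, y i := Finset.sum_le_sum fun i _ => minRatio_mul_le hq y i

/-- At value 1 the point dominates `q` coordinatewise, and equal coordinate sums force equality. -/
lemma minRatio_lt_one {q y : ι → ℝ} (hq : ∀ i, 0 < q i) (hq1 : ∑ i, q i = 1)
    (hy : y ∈ stdSimplex ℝ ι) (hne : y ≠ q) : minRatio q y < 1 := by
  refine lt_of_le_of_ne (minRatio_le_one hq hq1 hy) fun h => hne ?_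
  have hle : ∀ i ∈ Finset.univ, q i ≤ y i := fun i _ => by
    simpa [h] using minRatio_mul_le hq y i
  have := (Finset.sum_eq_sum_iff_of_le hle).1 (by rw [hq1, hy.2])
  exact funext fun i => (this i (Finset.mem_univ i)).symm

/-- Compare both minima at a coordinate where the one for `z` is attained. -/
lemma minRatio_sub_le {q y z : ι → ℝ} {κ e : ℝ} (hκ : 0 < κ) (hq : ∀ i, κ ≤ q i)
    (h : ∀ i, |y i - z i| ≤ e) : minRatio q y - minRatio q z ≤ e / κ := by
  have hq0 : ∀ i, 0 < q i := fun i => hκ.trans_le (hq i)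
  obtain ⟨i, hi⟩ := exists_eq_minRatio_mul hq0 z
  have h1 := minRatio_mul_le hq0 y i
  have h2 : (minRatio q y - minRatio q z) * q i ≤ e := by
    have := (le_abs_self _).trans (h i)
    linarith
  rcases le_or_gt (minRatio q y - minRatio q z) 0 with h3 | h3
  · have : 0 ≤ e := (abs_nonneg _).trans (h i)
    exact h3.trans (by positivity)
  · rw [le_div_iff₀ hκ]
    exact (mul_le_mul_of_nonneg_left (hq i) h3.le).trans h2

lemma abs_minRatio_sub_le {q y z : ι → ℝ} {κ e : ℝ} (hκ : 0 < κ) (hq : ∀ i, κ ≤ q i)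
    (h : ∀ i, |y i - z i| ≤ e) : |minRatio q y - minRatio q z| ≤ e / κ := by
  rw [abs_sub_le_iff]
  exact ⟨minRatio_sub_le hκ hq h,
    minRatio_sub_le hκ hq fun i => by rw [abs_sub_comm]; exact h i⟩

lemma radialProj_mem {q y : ι → ℝ} (hq : ∀ i, 0 < q i) (hq1 : ∑ i, q i = 1)
    (hy : y ∈ stdSimplex ℝ ι) (h : minRatio q y < 1) : radialProj q y ∈ simplexBoundary ι := by
  have h' : 0 < 1 - minRatio q y := by linarith
  refine ⟨⟨fun i => ?_, ?_⟩, ?_⟩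
  · exact div_nonneg (by linarith [minRatio_mul_le hq y i]) h'.le
  · simp only [radialProj]
    rw [← Finset.sum_div, Finset.sum_sub_distrib, ← Finset.mul_sum, hy.2, hq1, mul_one,
      div_self h'.ne']
  · obtain ⟨i, hi⟩ := exists_eq_minRatio_mul hq y
    exact ⟨i, by simp [radialProj, ← hi]⟩

lemma radialProj_eq_self {q y : ι → ℝ} (hq : ∀ i, 0 < q i) (hy : y ∈ simplexBoundary ι) :
    radialProj q y = y := by
  ext i; simp [radialProj, minRatio_eq_zero hq hy]

/-- The projection is singular only at `q`; the margin `ε` bounds its denominator away from 0. -/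
lemma abs_radialProj_sub_le {q y z : ι → ℝ} {κ e ε : ℝ} (hκ : 0 < κ) (hq : ∀ i, κ ≤ q i)
    (hq1 : ∑ i, q i = 1) (hz : z ∈ stdSimplex ℝ ι) (hε : 0 < ε)
    (hyε : ε ≤ 1 - minRatio q y) (hzε : ε ≤ 1 - minRatio q z)
    (h : ∀ i, |y i - z i| ≤ e) (i : ι) :
    |radialProj q y i - radialProj q z i| ≤ (1 + 2 / κ) / ε * e := by
  have hq0 : ∀ i, 0 < q i := fun i => hκ.trans_le (hq i)
  have hm := abs_minRatio_sub_le hκ hq h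
  have hz' := hε.trans_le hzε
  have hB := (radialProj_mem hq0 hq1 hz (by linarith)).1
  have hle : z i - minRatio q z * q i ≤ 1 - minRatio q z :=
    (div_le_one hz').1 (apply_le_one_of_mem_stdSimplex hB i)
  refine (abs_div_sub_div_le hε hyε hz' (by linarith [minRatio_mul_le hq0 z i]) hle).trans ?_
  have hqi : q i ≤ 1 := by
    rw [← hq1]; exact Finset.single_le_sum (fun j _ => (hq0 j).le) (Finset.mem_univ i)
  have h1 : |y i - minRatio q y * q i - (z i - minRatio q z * q i)| ≤ e + e / κ := by
    have : y i - minRatio q y * q i - (z i - minRatio q z * q i)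
      = (y i - z i) - (minRatio q y - minRatio q z) * q i := by ring
    rw [this]
    refine (abs_sub _ _).trans (add_le_add (h i) ?_)
    rw [abs_mul, abs_of_pos (hq0 i)]
    exact (mul_le_of_le_one_right (abs_nonneg _) hqi).trans hm
  have h2 : |1 - minRatio q y - (1 - minRatio q z)| ≤ e / κ := by
    rw [show 1 - minRatio q y - (1 - minRatio q z) = -(minRatio q y - minRatio q z) by ring,
      abs_neg]
    exact hm
  calc _ ≤ (e + e / κ + e / κ) / ε := by gcongr
    _ = _ := by field_simp; ring

end MinRatio

/-! ### Lipschitz extension into the full simplex. -/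

section SimplexExtension

variable {X : Type*} [MetricSpace X] {ι : Type*} [Fintype ι]

lemma exists_lipschitz_extension_real {K : ℝ} (hK : 0 ≤ K) {A : Set X} {f : X → ℝ}
    (hf : ∀ a ∈ A, ∀ b ∈ A, |f a - f b| ≤ K * dist a b) :
    ∃ g : X → ℝ, (∀ x y, |g x - g y| ≤ K * dist x y) ∧ ∀ a ∈ A, g a = f a := by
  lift K to ℝ≥0 using hK
  have h : LipschitzOnWith K f A := LipschitzOnWith.of_dist_le_mul fun a ha b hb => by
    simpa [Real.dist_eq] using hf a ha b hb
  obtain ⟨g, hg, he⟩ := h.extend_real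
  refine ⟨g, fun x y => ?_, fun a ha => (he ha).symm⟩
  simpa [Real.dist_eq] using hg.dist_le_mul x y

/-- A Lipschitz retraction of `ι → ℝ` onto the standard simplex. -/
noncomputable def simplexRetract (y : ι → ℝ) (i : ι) : ℝ :=
  (max (y i) 0 + max (1 - ∑ j, max (y j) 0) 0 / Fintype.card ι) / max (∑ j, max (y j) 0) 1

lemma simplexRetract_mem [Nonempty ι] (y : ι → ℝ) : simplexRetract y ∈ stdSimplex ℝ ι := by
  have h1 : (0 : ℝ) < max (∑ j, max (y j) 0) 1 := zero_lt_one.trans_le (le_max_right _ _)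
  refine ⟨fun i => div_nonneg (add_nonneg (le_max_right _ _)
    (div_nonneg (le_max_right _ _) (Nat.cast_nonneg _))) h1.le, ?_⟩
  simp only [simplexRetract]
  rw [← Finset.sum_div, div_eq_one_iff_eq h1.ne', Finset.sum_add_distrib, Finset.sum_const,
    Finset.card_univ, nsmul_eq_mul, mul_div_cancel₀ _ (by simp)]
  -- Mass below 1 is topped up equally over the coordinates; mass above 1 is normalised by the
  -- division.
  rcases le_total (∑ j, max (y j) 0) 1 with h | h
  · rw [max_eq_right h, max_eq_left (by linarith)]; ring
  · rw [max_eq_left h, max_eq_right (by linarith)]; ring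

lemma simplexRetract_eq_self {y : ι → ℝ} (hy : y ∈ stdSimplex ℝ ι) : simplexRetract y = y := by
  ext i
  have h : ∀ j, max (y j) 0 = y j := fun j => max_eq_left (hy.1 j)
  simp [simplexRetract, h, hy.2]

lemma abs_simplexRetract_sub_le [Nonempty ι] {y z : ι → ℝ} {e : ℝ} (h : ∀ i, |y i - z i| ≤ e)
    (i : ι) : |simplexRetract y i - simplexRetract z i| ≤ (Fintype.card ι + 2) * e := by
  have he : 0 ≤ e := (abs_nonneg _).trans (h i)
  have hN : (0 : ℝ) < Fintype.card ι := by exact_mod_cast Fintype.card_pos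
  have hpos : ∀ a b : ℝ, |max a 0 - max b 0| ≤ |a - b| := fun a b =>
    (abs_max_sub_max_le_max a 0 b 0).trans (max_le le_rfl (by simp))
  have hs : |∑ j, max (y j) 0 - ∑ j, max (z j) 0| ≤ Fintype.card ι * e := by
    rw [← Finset.sum_sub_distrib]
    refine (Finset.abs_sum_le_sum_abs _ _).trans ?_
    refine (Finset.sum_le_sum fun j _ => (hpos _ _).trans (h j)).trans ?_
    simp
  have hz := simplexRetract_mem z
  have h1 : (0 : ℝ) < max (∑ j, max (z j) 0) 1 := zero_lt_one.trans_le (le_max_right _ _)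
  refine (abs_div_sub_div_le one_pos (le_max_right _ _) h1 ?_
    ((div_le_one h1).1 (apply_le_one_of_mem_stdSimplex hz i))).trans ?_
  · exact add_nonneg (le_max_right _ _) (div_nonneg (le_max_right _ _) hN.le)
  rw [div_one]
  have h2 : |max (1 - ∑ j, max (y j) 0) 0 / (Fintype.card ι : ℝ)
      - max (1 - ∑ j, max (z j) 0) 0 / (Fintype.card ι : ℝ)| ≤ e := by
    rw [← sub_div, abs_div, abs_of_pos hN, div_le_iff₀ hN]
    refine (hpos _ _).trans ?_
    rw [sub_sub_sub_cancel_left, abs_sub_comm, mul_comm]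
    exact hs
  have h3 : |max (∑ j, max (y j) 0) 1 - max (∑ j, max (z j) 0) 1| ≤ Fintype.card ι * e :=
    (abs_max_sub_max_le_max _ _ _ _).trans (max_le hs (by simp; positivity))
  have h4 := (hpos (y i) (z i)).trans (h i)
  rw [add_sub_add_comm]
  have h5 := abs_add_le (max (y i) 0 - max (z i) 0)
    (max (1 - ∑ j, max (y j) 0) 0 / (Fintype.card ι : ℝ)
      - max (1 - ∑ j, max (z j) 0) 0 / (Fintype.card ι : ℝ))
  linarith

/-- The standard simplex is an absolute Lipschitz extensor. -/
lemma exists_lipschitz_extension_stdSimplex [Nonempty ι] {K : ℝ} (hK : 0 ≤ K) {A : Set X}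
    {f : X → ι → ℝ} (hfA : ∀ a ∈ A, f a ∈ stdSimplex ℝ ι)
    (hf : ∀ a ∈ A, ∀ b ∈ A, ∀ i, |f a i - f b i| ≤ K * dist a b) :
    ∃ g : X → ι → ℝ, (∀ x, g x ∈ stdSimplex ℝ ι) ∧
      (∀ x y i, |g x i - g y i| ≤ (Fintype.card ι + 2) * K * dist x y) ∧
      ∀ a ∈ A, g a = f a := by
  have h := fun i => exists_lipschitz_extension_real (f := fun x => f x i) hK
    (fun a ha b hb => hf a ha b hb i)
  choose g hg he using h
  refine ⟨fun x => simplexRetract fun i => g i x, fun x => simplexRetract_mem _,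
    fun x y i => ?_, fun a ha => ?_⟩
  · rw [mul_assoc]
    exact abs_simplexRetract_sub_le (fun j => hg j x y) i
  · change simplexRetract (fun i => g i a) = f a
    rw [show (fun i => g i a) = f a from funext fun i => he i a ha]
    exact simplexRetract_eq_self (hfA a ha)

/-- The boundary of the standard simplex on the vertex set `ι`, with the sup metric, is a Lipschitz
extensor of `X`. -/
def BoundaryExtensor (ι X : Type*) [Fintype ι] [MetricSpace X] : Prop :=
  ∃ C : ℝ, 0 < C ∧ ∀ K : ℝ, 0 ≤ K → ∀ (A : Set X) (f : X → ι → ℝ),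
    (∀ a ∈ A, f a ∈ simplexBoundary ι) →
    (∀ a ∈ A, ∀ b ∈ A, ∀ i, |f a i - f b i| ≤ K * dist a b) →
    ∃ g : X → ι → ℝ, (∀ x, g x ∈ simplexBoundary ι) ∧
      (∀ x y i, |g x i - g y i| ≤ C * K * dist x y) ∧ ∀ a ∈ A, g a = f a

end SimplexExtension

/-! ### Comparison of the `ℓ_p` and sup metrics on the sphere. -/

section Transfer

lemma simplexBoundary_nonempty (n : ℕ) : (simplexBoundary (Fin (n + 2))).Nonempty :=
  ⟨Pi.single 0 1, single_mem_stdSimplex ℝ 0, 1, by simp⟩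

lemma toLp_mem_simplexSphere {p : ℝ≥0∞} {n : ℕ} {x : Fin (n + 2) → ℝ}
    (hx : x ∈ simplexBoundary (Fin (n + 2))) : WithLp.toLp p x ∈ simplexSphere p n := hx

lemma ofLp_mem_simplexBoundary {p : ℝ≥0∞} {n : ℕ} {x : PiLp p fun _ : Fin (n + 2) => ℝ}
    (hx : x ∈ simplexSphere p n) : x.ofLp ∈ simplexBoundary (Fin (n + 2)) := hx

lemma isLipschitzExtensor_simplexSphere_iff {X : Type*} [MetricSpace X] (n : ℕ)
    (p : ℝ≥0∞) [Fact (1 ≤ p)] :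
    IsLipschitzExtensor (simplexSphere p n) X ↔ BoundaryExtensor (Fin (n + 2)) X := by
  classical
  set c : ℝ≥0 := (Fintype.card (Fin (n + 2)) : ℝ≥0) ^ (1 / p).toReal with hc
  have hc0 : 0 < c := by rw [hc]; apply NNReal.rpow_pos; simp
  have hle : ∀ (y z : PiLp p (fun _ : Fin (n + 2) => ℝ)) i, |y i - z i| ≤ dist y z := by
    intro y z i
    have := (PiLp.lipschitzWith_ofLp p (fun _ : Fin (n + 2) => ℝ)).dist_le_mul y z
    rw [NNReal.coe_one, one_mul] at this
    exact (Real.dist_eq _ _).symm.le.trans ((dist_le_pi_dist y.ofLp z.ofLp i).trans this)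
  have hge : ∀ (y z : PiLp p (fun _ : Fin (n + 2) => ℝ)) (e : ℝ), 0 ≤ e →
      (∀ i, |y i - z i| ≤ e) → dist y z ≤ c * e := by
    intro y z e he h
    have := (PiLp.antilipschitzWith_ofLp p (fun _ : Fin (n + 2) => ℝ)).le_mul_dist y z
    refine this.trans ?_
    rw [hc]
    gcongr
    exact (dist_pi_le_iff he).2 fun i => by rw [Real.dist_eq]; exact h i
  constructor
  · rintro ⟨C, hC, H⟩
    refine ⟨C * c, by positivity, fun K hK A f hfA hf => ?_⟩
    lift K to ℝ≥0 using hK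
    obtain ⟨g, hg, hgA⟩ := H (c * K) A
      (fun a => ⟨WithLp.toLp p (f a), toLp_mem_simplexSphere (hfA a a.2)⟩) (LipschitzWith.of_dist_le_mul fun a b => by
        rw [Subtype.dist_eq, NNReal.coe_mul, mul_assoc]
        exact hge _ _ _ (by positivity) fun i => hf a a.2 b b.2 i)
    refine ⟨fun x => (g x).1.ofLp, fun x => ofLp_mem_simplexBoundary (g x).2, fun x y i => ?_, fun a ha => ?_⟩
    · refine (hle _ _ i).trans ?_
      have := hg.dist_le_mul x y
      rw [Subtype.dist_eq] at this
      simpa [mul_assoc] using this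
    · exact congrArg (fun z => z.1.ofLp) (hgA ⟨a, ha⟩)
  · rintro ⟨C, hC, H⟩
    lift C to ℝ≥0 using hC.le
    refine ⟨c * C, mul_pos hc0 (by exact_mod_cast hC), fun K A f hf => ?_⟩
    -- `z` is a default value off `A`, where the function fed to `H` is irrelevant.
    obtain ⟨z, hz⟩ := simplexBoundary_nonempty n
    obtain ⟨g, hgm, hg, hgA⟩ := H K K.2 A
      (fun x => if h : x ∈ A then (f ⟨x, h⟩).1.ofLp else z)
      (fun a ha => by simp only [ha, dif_pos]; exact (f ⟨a, ha⟩).2)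
      (fun a ha b hb i => by
        simp only [ha, hb, dif_pos]
        exact (hle _ _ i).trans (hf.dist_le_mul ⟨a, ha⟩ ⟨b, hb⟩))
    refine ⟨fun x => ⟨WithLp.toLp p (g x), toLp_mem_simplexSphere (hgm x)⟩, LipschitzWith.of_dist_le_mul fun x y => ?_,
      fun a => ?_⟩
    · rw [Subtype.dist_eq, NNReal.coe_mul, NNReal.coe_mul, mul_assoc, mul_assoc]
      refine hge _ _ _ (by positivity) fun i => ?_
      rw [← mul_assoc]
      exact hg x y i
    · apply Subtype.ext
      simp only [hgA a a.2, Subtype.coe_prop, dif_pos]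

end Transfer

/-! ### Covers, partitions of unity and lowering the dimension by one. -/

section Covers

variable {X : Type*} [MetricSpace X]

/-- A space of Nagata–Assouad dimension at most `n` has, at every scale `r`, partitions of unity
with `n + 1` members whose supports split into `r`-separated pieces of size comparable to `r`;
`b i x` is the label of the piece of the `i`-th support that contains `x`. -/
lemma NagataDimLE.exists_partition {n : ℕ} (h : NagataDimLE X n) :
    ∃ C : ℝ, 1 ≤ C ∧ ∀ r : ℝ, 0 < r →
      ∃ (w : X → Fin (n + 1) → ℝ) (b : Fin (n + 1) → X → X),
        (∀ x, w x ∈ stdSimplex ℝ (Fin (n + 1))) ∧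
        (∀ x y i, |w x i - w y i| ≤ C / r * dist x y) ∧
        (∀ i x, 0 < w x i → dist x (b i x) ≤ C * r) ∧
        ∀ i x y, 0 < w x i → 0 < w y i → dist x y < r → b i x = b i y := by
  classical
  obtain ⟨C, hC, H⟩ := h
  refine ⟨3 * C + (n + 2), by linarith [Nat.cast_nonneg (α := ℝ) n], fun r hr => ?_⟩
  -- Scale `3 * r` leaves room for enlarging the pieces by `r`: points closer than `r` whose
  -- distances to their pieces are below `r` belong to the same piece.
  obtain ⟨𝒰, hcov, hdisj, hdiam⟩ := H (3 * r) (by positivity)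
  set T : Fin (n + 1) → Set X := fun i => ⋃₀ 𝒰 i with hT
  -- The empty case is separate because `Metric.infDist` to the empty set is 0, which would give
  -- weight 1.
  set ω : Fin (n + 1) → X → ℝ := fun i x =>
    if (T i).Nonempty then max 0 (1 - Metric.infDist x (T i) / r) else 0 with hω
  have ω_nonneg : ∀ i x, 0 ≤ ω i x := fun i x => by
    simp only [hω]; split_ifs; exacts [le_max_left _ _, le_rfl]
  have ω_pos : ∀ i x, 0 < ω i x → ∃ U ∈ 𝒰 i, ∃ z ∈ U, dist x z < r := by
    intro i x hx
    simp only [hω] at hx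
    split_ifs at hx with hne
    · rw [lt_max_iff] at hx
      have h1 : Metric.infDist x (T i) < r := by
        rcases hx with hx | hx
        · exact absurd hx (lt_irrefl _)
        · exact (div_lt_one hr).1 (by linarith)
      obtain ⟨z, ⟨U, hU, hz⟩, hd⟩ := (Metric.infDist_lt_iff hne).1 h1
      exact ⟨U, hU, z, hz, hd⟩
    · exact absurd hx (lt_irrefl _)
  have ω_lip : ∀ i x y, |ω i x - ω i y| ≤ 1 / r * dist x y := by
    intro i x y
    simp only [hω]
    split_ifs with hne
    · refine (abs_max_sub_max_le_max _ _ _ _).trans (max_le (by simp; positivity) ?_)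
      rw [sub_sub_sub_cancel_left, ← sub_div, abs_div, abs_of_pos hr, div_eq_inv_mul, one_div]
      gcongr
      have := (Metric.lipschitz_infDist_pt (T i)).dist_le_mul y x
      rwa [NNReal.coe_one, one_mul, Real.dist_eq, dist_comm] at this
    · simp; positivity
  have ω_sum : ∀ x, 1 ≤ ∑ i, ω i x := by
    intro x
    obtain ⟨i, U, hU, hx⟩ := hcov x
    have hxT : x ∈ T i := ⟨U, hU, hx⟩
    refine le_trans ?_ (Finset.single_le_sum (fun j _ => ω_nonneg j x) (Finset.mem_univ i))
    simp [hω, if_pos (show (T i).Nonempty from ⟨x, hxT⟩), Metric.infDist_zero_of_mem hxT]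
  -- A chosen point labels each nonempty piece; `x` only serves as a default for the empty one.
  set rep : Set X → X → X := fun U x => if hU : U.Nonempty then hU.some else x with hrep
  have rep_mem : ∀ (U : Set X) x, U.Nonempty → rep U x ∈ U := fun U x hU => by
    simp only [hrep, hU, dif_pos]; exact hU.some_mem
  have rep_eq : ∀ (U : Set X) x y, U.Nonempty → rep U x = rep U y := fun U x y hU => by
    simp only [hrep, hU, dif_pos]
  have hb : ∀ i x, ∃ b, 0 < ω i x → ∃ U ∈ 𝒰 i, b = rep U x ∧ ∃ z ∈ U, dist x z < r := by
    intro i x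
    by_cases hx : 0 < ω i x
    · obtain ⟨U, hU, hz⟩ := ω_pos i x hx
      exact ⟨rep U x, fun _ => ⟨U, hU, rfl, hz⟩⟩
    · exact ⟨x, fun h => absurd h hx⟩
  choose b hb using hb
  have hpos : ∀ x i, 0 < ω i x / ∑ j, ω j x → 0 < ω i x := fun x i h =>
    (div_pos_iff_of_pos_right (one_pos.trans_le (ω_sum x))).1 h
  refine ⟨fun x i => ω i x / ∑ j, ω j x, b, fun x => ⟨fun i => ?_, ?_⟩, fun x y i => ?_,
    fun i x hx => ?_, fun i x y hx hy hxy => ?_⟩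
  · exact div_nonneg (ω_nonneg i x) (zero_le_one.trans (ω_sum x))
  · rw [← Finset.sum_div, div_self (one_pos.trans_le (ω_sum x)).ne']
  · refine (abs_div_sub_div_le one_pos (ω_sum x) (one_pos.trans_le (ω_sum y)) (ω_nonneg i y)
      (Finset.single_le_sum (f := fun j => ω j y) (fun j _ => ω_nonneg j y)
        (Finset.mem_univ i))).trans ?_
    have h1 : |∑ j, ω j x - ∑ j, ω j y| ≤ (n + 1) * (1 / r * dist x y) := by
      rw [← Finset.sum_sub_distrib]
      refine (Finset.abs_sum_le_sum_abs _ _).trans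
        ((Finset.sum_le_sum fun j _ => ω_lip j x y).trans ?_)
      simp
    have h2 : 0 ≤ C * (1 / r * dist x y) := by positivity
    have h3 : (3 * C + (n + 2)) / r * dist x y = 3 * (C * (1 / r * dist x y))
      + (n + 2) * (1 / r * dist x y) := by ring
    rw [div_one, h3]
    linarith [ω_lip i x y]
  · obtain ⟨U, hU, hbU, z, hz, hd⟩ := hb i x (hpos x i hx)
    have h1 := hdiam i U hU z hz (b i x) (hbU ▸ rep_mem U x ⟨z, hz⟩)
    have h2 : 0 ≤ n * r := by positivity
    linarith [dist_triangle x z (b i x)]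
  · obtain ⟨U, hU, hbU, z, hz, hd⟩ := hb i x (hpos x i hx)
    obtain ⟨V, hV, hbV, z', hz', hd'⟩ := hb i y (hpos y i hy)
    have hUV : U = V := by
      by_contra hne
      have h1 := hdisj i U hU V hV hne z hz z' hz'
      have h2 := dist_triangle4 z x y z'
      rw [dist_comm z x] at h2
      linarith
    rw [hbU, hbV, ← hUV]
    exact rep_eq U x y ⟨z, hz⟩

lemma NagataDimLE.mono {m n : ℕ} (h : NagataDimLE X m) (hmn : m ≤ n) : NagataDimLE X n := by
  obtain ⟨C, hC, H⟩ := h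
  refine ⟨C, hC, fun r hr => ?_⟩
  obtain ⟨𝒰, hcov, hdisj, hdiam⟩ := H r hr
  refine ⟨fun i => if h : i.1 < m + 1 then 𝒰 ⟨i, h⟩ else ∅, fun x => ?_, fun i => ?_, fun i => ?_⟩
  · obtain ⟨i, hi⟩ := hcov x
    exact ⟨⟨i, by omega⟩, by simpa [Nat.lt_succ_iff.1 i.2] using hi⟩
  · by_cases h : i.1 < m + 1
    · simpa [h] using hdisj ⟨i, h⟩
    · simp [h, RDisjoint]
  · by_cases h : i.1 < m + 1
    · simpa [h] using hdiam ⟨i, h⟩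
    · simp [h]

/-- A point of the boundary of the simplex has a gap of definite size between its larger and its
smaller coordinates. -/
lemma exists_gap_of_mem_simplexBoundary {ι : Type*} [Fintype ι] {v : ι → ℝ}
    (hv : v ∈ simplexBoundary ι) :
    ∃ S : Finset ι, S.Nonempty ∧ S.card < Fintype.card ι ∧
      ∀ i ∈ S, ∀ j ∉ S, v j + 1 / (Fintype.card ι : ℝ) ^ 2 ≤ v i := by
  classical
  obtain ⟨⟨hv0, hv1⟩, i₀, hi₀⟩ := hv
  set N := Fintype.card ι with hN
  have hNpos : 0 < N := Fintype.card_pos_iff.2 ⟨i₀⟩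
  have hNR : (0 : ℝ) < N := by exact_mod_cast hNpos
  -- Pigeonhole on superlevel sets: the `N` thresholds are below the average `1 / N`, so each set is
  -- nonempty, and each omits `i₀`. Two of these `N` nested sets share one of `N - 1` sizes, so they
  -- coincide and no coordinate lies between their thresholds.
  set S : ℕ → Finset ι := fun k => Finset.univ.filter fun i => (k : ℝ) / N ^ 2 < v i with hS
  have hmem : ∀ k i, i ∈ S k ↔ (k : ℝ) / N ^ 2 < v i := fun k i => by simp [hS]
  have hne : ∀ k < N, (S k).Nonempty := by
    intro k hk
    by_contra hem
    rw [Finset.not_nonempty_iff_eq_empty] at hem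
    have h1 : ∀ i ∈ Finset.univ, v i ≤ (k : ℝ) / N ^ 2 := fun i _ => by
      by_contra hlt
      have := (hmem k i).2 (not_le.1 hlt)
      simp [hem] at this
    have h2 := Finset.sum_le_sum h1
    rw [hv1, Finset.sum_const, Finset.card_univ, nsmul_eq_mul, ← hN] at h2
    have h3 : (N : ℝ) * (k / N ^ 2) = k / N := by field_simp
    rw [h3, one_le_div hNR] at h2
    exact absurd (by exact_mod_cast h2 : N ≤ k) (by omega)
  have hlt : ∀ k, (S k).card < N := fun k => by
    refine Finset.card_lt_univ_of_notMem (x := i₀) ?_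
    rw [hmem, hi₀, not_lt]
    positivity
  obtain ⟨k, hk, l, hl, hkl, heq⟩ : ∃ k ∈ Finset.range N, ∃ l ∈ Finset.range N, k ≠ l ∧
      (S k).card = (S l).card := by
    refine Finset.exists_ne_map_eq_of_card_lt_of_maps_to (t := Finset.Ico 1 N) ?_ fun k hk => ?_
    · simp; omega
    · have := (hne k (Finset.mem_range.1 hk)).card_pos
      simp only [Finset.coe_Ico, Set.mem_Ico]
      exact ⟨this, hlt k⟩
  wlog hlt' : k < l generalizing k l
  · exact this l hl k hk hkl.symm heq.symm (by omega)
  have hsub : S l ⊆ S k := fun i hi => by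
    rw [hmem] at hi ⊢
    refine lt_of_le_of_lt ?_ hi
    gcongr
  have hSeq : S l = S k := Finset.eq_of_subset_of_card_le hsub heq.le
  refine ⟨S l, hne l (Finset.mem_range.1 hl), hlt l, fun i hi j hj => ?_⟩
  rw [hSeq, hmem, not_lt] at hj
  rw [hmem] at hi
  have : ((k : ℝ) + 1) / N ^ 2 ≤ l / N ^ 2 := by
    gcongr
    exact_mod_cast hlt'
  rw [add_div] at this
  linarith

/-- If the `n`-sphere is a Lipschitz extensor of a space of dimension at most `n + 1`, then that
space has dimension at most `n`. -/
lemma NagataDimLE.of_succ_of_boundaryExtensor {n : ℕ} (h : NagataDimLE X (n + 1))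
    (hE : BoundaryExtensor (Fin (n + 2)) X) : NagataDimLE X n := by
  obtain ⟨C, hC, H⟩ := h.exists_partition
  obtain ⟨D, hD, HE⟩ := hE
  have hC0 : 0 < C := by linarith
  set η : ℝ := 1 / ((n + 2 : ℕ) : ℝ) ^ 2 with hη
  have hη0 : 0 < η := by positivity
  -- Coarsening the partition by `κ` makes the extension `v` vary by less than the gap `η` over
  -- distances below `r`.
  set κ : ℝ := 1 + D * C / η with hκ
  have hκ1 : 1 ≤ κ := by rw [hκ]; linarith [show 0 ≤ D * C / η by positivity]
  refine ⟨2 * C * κ, by positivity, fun r hr => ?_⟩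
  obtain ⟨w, b, hw, hwl, hwb, hbe⟩ := H (κ * r) (by positivity)
  -- Where some weight of `w` vanishes, `v` equals `w`; hence supports do not grow and the labels
  -- `b` remain valid for `v`.
  obtain ⟨v, hv, hvl, hve⟩ := HE (C / (κ * r)) (by positivity) {x | w x ∈ simplexBoundary _} w
    (fun a ha => ha) (fun a _ b _ i => hwl a b i)
  have hvw : ∀ x i, 0 < v x i → 0 < w x i := by
    intro x i hx
    by_cases hxA : w x ∈ simplexBoundary (Fin (n + 2))
    · rwa [hve x hxA] at hx
    · by_contra hle
      exact hxA ⟨hw x, i, le_antisymm (not_lt.1 hle) ((hw x).1 i)⟩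
  set P : Finset (Fin (n + 2)) → (Fin (n + 2) → X) → Set X := fun S c =>
    {x | (∀ i ∈ S, ∀ j ∉ S, v x j + η ≤ v x i) ∧ (∀ i ∈ S, 0 < v x i) ∧ ∀ i ∈ S, b i x = c i}
    with hP
  have hclose : ∀ x y i, dist x y < r → |v x i - v y i| < η := by
    intro x y i hxy
    refine (hvl x y i).trans_lt ?_
    have h1 : D * (C / (κ * r)) * dist x y < D * (C / (κ * r)) * r := by
      gcongr
    refine h1.trans_le ?_
    have h2 : D * (C / (κ * r)) * r = D * C / κ := by field_simp
    rw [h2, div_le_iff₀ (by positivity), hκ]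
    have : η * (1 + D * C / η) = η + D * C := by field_simp
    linarith
  -- The set `S` of large coordinates is nonempty and proper, so its size runs over `1, …, n + 1`:
  -- exactly `n + 1` families.
  refine ⟨fun k => {U | ∃ S c, S.card = k.1 + 1 ∧ U = P S c}, fun x => ?_, fun k => ?_,
    fun k => ?_⟩
  · obtain ⟨S, hSne, hSc, hgap⟩ := exists_gap_of_mem_simplexBoundary (hv x)
    rw [Fintype.card_fin] at hSc hgap
    have hpos := hSne.card_pos
    refine ⟨⟨S.card - 1, by omega⟩, P S fun i => b i x, ⟨S, _, by simp; omega, rfl⟩, hgap,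
      fun i hi => ?_, fun i _ => rfl⟩
    obtain ⟨j, hj⟩ : ∃ j, j ∉ S := by
      by_contra! hall
      have : S = Finset.univ := Finset.eq_univ_of_forall hall
      rw [this] at hSc
      simp at hSc
    linarith [hgap i hi j hj, (hv x).1.1 j]
  · rintro _ ⟨S, c, hS, rfl⟩ _ ⟨S', c', hS', rfl⟩ hne x ⟨hx1, hx2, hx3⟩ y ⟨hy1, hy2, hy3⟩
    by_contra hlt
    rw [not_le] at hlt
    -- Distinct sets of equal size each contain an index missing from the other. Exchanging the
    -- order of those two coordinates needs a total change of `2 * η`, but each moves by less than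
    -- `η`.
    have hSS : S = S' := by
      by_contra hSne
      obtain ⟨i, hi, hi'⟩ : ∃ i ∈ S, i ∉ S' := by
        by_contra! hsub
        exact hSne (Finset.eq_of_subset_of_card_le hsub (by omega))
      obtain ⟨j, hj', hj⟩ : ∃ j ∈ S', j ∉ S := by
        by_contra! hsub
        exact hSne (Finset.eq_of_subset_of_card_le hsub (by omega)).symm
      have h1 := hx1 i hi j hj
      have h2 := hy1 j hj' i hi'
      have h3 := abs_lt.1 (hclose x y i hlt)
      have h4 := abs_lt.1 (hclose x y j hlt)
      linarith
    subst hSS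
    have hcc : ∀ i ∈ S, c i = c' i := fun i hi => by
      rw [← hx3 i hi, ← hy3 i hi]
      refine hbe i x y (hvw x i (hx2 i hi)) (hvw y i (hy2 i hi)) (hlt.trans_le ?_)
      nlinarith
    -- `P S c` depends only on the labels `c i` with `i ∈ S`.
    refine hne (Set.ext fun z => ?_)
    simp only [hP, Set.mem_ofPred_eq]
    refine and_congr_right fun _ => and_congr_right fun _ => forall₂_congr fun i hi => ?_
    rw [hcc i hi]
  · rintro _ ⟨S, c, hS, rfl⟩ x ⟨-, hx2, hx3⟩ y ⟨-, hy2, hy3⟩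
    obtain ⟨i, hi⟩ : S.Nonempty := Finset.card_pos.1 (by omega)
    have h1 := hwb i x (hvw x i (hx2 i hi))
    have h2 := hwb i y (hvw y i (hy2 i hi))
    rw [hx3 i hi] at h1
    rw [hy3 i hi] at h2
    have := dist_triangle_right x y (c i)
    calc dist x y ≤ C * (κ * r) + C * (κ * r) := by linarith
      _ = 2 * C * κ * r := by ring

end Covers

/-! ### Suspension of spheres and descent in dimension. -/

section Suspension

variable {X : Type*} [MetricSpace X]

/-- If the `n`-sphere is a Lipschitz extensor of `X`, then so is its suspension. -/
lemma BoundaryExtensor.succ {n : ℕ} (hE : BoundaryExtensor (Fin (n + 2)) X) :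
    BoundaryExtensor (Fin (n + 3)) X := by
  classical
  obtain ⟨D, hD, HE⟩ := hE
  set N : ℝ := ((n + 2 : ℕ) : ℝ) with hN
  have hN1 : 1 ≤ N := by rw [hN]; exact_mod_cast (by omega : 1 ≤ n + 2)
  have hN0 : 0 < N := by linarith
  -- Collapsing the extra vertex 0 onto the barycentre `q` sends each hemisphere of the larger
  -- sphere onto the smaller simplex, with the equator going to its boundary.
  set q : Fin (n + 2) → ℝ := fun _ => 1 / N with hq
  have hq0 : ∀ i, 0 < q i := fun i => by positivity
  have hq1 : ∑ i, q i = 1 := by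
    simp only [hq, Finset.sum_const, Finset.card_univ, Fintype.card_fin, nsmul_eq_mul]
    rw [← hN]; field_simp
  have hqκ : ∀ i, 1 / N ≤ q i := fun i => le_rfl
  have hqle : ∀ i, q i ≤ 1 := fun i => (div_le_one hN0).2 hN1
  have hqmem : q ∈ stdSimplex ℝ (Fin (n + 2)) := ⟨fun i => (hq0 i).le, hq1⟩
  -- the Lipschitz constants (in units of the given one) of the successive maps
  set Ly : ℝ := (N + 2) * 2 with hLy
  set Lg : ℝ := D * ((1 + 2 * N) / (1 / 2) * 2) with hLg
  set L' : ℝ := 8 * (N + 1) + Ly + (2 * (N + 1) + Lg) with hL'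
  refine ⟨4 * (N + 1) + N * L' + L', by positivity, fun K hK A f hfA hf => ?_⟩
  -- height and projection on the sphere
  set tl : X → Fin (n + 2) → ℝ := fun x i => f x i.succ with htl
  set s : X → ℝ := fun x => f x 0 - minRatio q (tl x) with hs
  set y : X → Fin (n + 2) → ℝ := fun x i => tl x i + f x 0 * q i with hy
  have hd : ∀ a ∈ A, ∀ b ∈ A, ∀ i, |tl a i - tl b i| ≤ K * dist a b :=
    fun a ha b hb i => hf a ha b hb i.succ
  have hs_lip : ∀ a ∈ A, ∀ b ∈ A, |s a - s b| ≤ (N + 1) * K * dist a b := by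
    intro a ha b hb
    have h1 := abs_minRatio_sub_le (by positivity) hqκ (hd a ha b hb)
    have h2 := hf a ha b hb 0
    rw [div_div_eq_mul_div, div_one] at h1
    have h3 : s a - s b = (f a 0 - f b 0) - (minRatio q (tl a) - minRatio q (tl b)) := by
      simp only [hs]; ring
    rw [h3]
    refine (abs_sub _ _).trans ?_
    linarith
  have hy_lip : ∀ a ∈ A, ∀ b ∈ A, ∀ i, |y a i - y b i| ≤ 2 * K * dist a b := by
    intro a ha b hb i
    have h1 := hd a ha b hb i
    have h2 := hf a ha b hb 0
    have h3 : y a i - y b i = (tl a i - tl b i) + (f a 0 - f b 0) * q i := by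
      simp only [hy]; ring
    rw [h3]
    refine (abs_add_le _ _).trans ?_
    rw [abs_mul, abs_of_pos (hq0 i)]
    have := mul_le_of_le_one_right (abs_nonneg (f a 0 - f b 0)) (hqle i)
    linarith
  have hy_mem : ∀ a ∈ A, y a ∈ stdSimplex ℝ (Fin (n + 2)) := by
    intro a ha
    have hb := (hfA a ha).1
    refine ⟨fun i => add_nonneg (hb.1 _) (mul_nonneg (hb.1 0) (hq0 i).le), ?_⟩
    have := hb.2
    rw [Fin.sum_univ_succ] at this
    simp only [hy]
    rw [Finset.sum_add_distrib, ← Finset.mul_sum, hq1, mul_one, add_comm]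
    exact this
  have hmy : ∀ a, minRatio q (y a) = minRatio q (tl a) + f a 0 := fun a =>
    minRatio_add_mul hq0 (tl a) (f a 0)
  have htl0 : ∀ a ∈ A, 0 ≤ minRatio q (tl a) := fun a ha =>
    minRatio_nonneg hq0 fun i => (hfA a ha).1.1 _
  have hzero : ∀ a ∈ A, f a 0 = 0 ∨ minRatio q (tl a) = 0 := by
    intro a ha
    obtain ⟨i, hi⟩ := (hfA a ha).2
    rcases Fin.eq_zero_or_eq_succ i with rfl | ⟨j, rfl⟩
    · exact Or.inl hi
    · exact Or.inr (minRatio_eq_of_le hq0 (fun k => by simpa [htl] using (hfA a ha).1.1 _) j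
        (by simpa [htl] using hi))
  -- One of the two terms of `s` always vanishes, so the projection `y` and the sign of `s`
  -- determine `f`.
  have hms : ∀ a ∈ A, minRatio q (y a) = |s a| := by
    intro a ha
    rw [hmy]
    simp only [hs]
    rcases hzero a ha with h | h
    · rw [h, zero_sub, abs_neg, abs_of_nonneg (htl0 a ha), add_zero]
    · rw [h, sub_zero, abs_of_nonneg ((hfA a ha).1.1 0), zero_add]
  -- extensions of the height and of the projection
  obtain ⟨s₁, hs₁_lip, hs₁A⟩ := exists_lipschitz_extension_real (by positivity) hs_lip
  set σ : X → ℝ := fun x => max (-1) (min 1 (s₁ x)) with hσ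
  have hσ_lip : ∀ x z, |σ x - σ z| ≤ (N + 1) * K * dist x z := fun x z =>
    (abs_max_sub_max_le_max _ _ _ _).trans (max_le (by simp; positivity)
      ((abs_min_sub_min_le_max _ _ _ _).trans (max_le (by simp; positivity) (hs₁_lip x z))))
  have hσ1 : ∀ x, |σ x| ≤ 1 := fun x => abs_le.2
    ⟨le_max_left _ _, max_le (by norm_num) (min_le_left _ _)⟩
  have hσA : ∀ a ∈ A, σ a = s a := by
    intro a ha
    have h1 := hms a ha ▸ minRatio_le_one hq0 hq1 (hy_mem a ha)
    rw [abs_le] at h1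
    simp only [hσ, hs₁A a ha]
    rw [min_eq_right h1.2, max_eq_right h1.1]
  have hσabs : ∀ x z, |(|σ x| - |σ z|)| ≤ (N + 1) * K * dist x z := fun x z =>
    (abs_abs_sub_abs_le_abs_sub _ _).trans (hσ_lip x z)
  obtain ⟨Y, hY_mem, hY_lip, hYA⟩ :=
    exists_lipschitz_extension_stdSimplex (by positivity) hy_mem hy_lip
  -- the extension over the neighbourhood of the equator
  obtain ⟨g, hg_mem, hg_lip, hgA⟩ := HE ((1 + 2 * N) / (1 / 2) * (2 * K)) (by positivity)
    (A ∩ {x | |s x| ≤ 1 / 2}) (fun x => radialProj q (y x))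
    (fun a ha => radialProj_mem hq0 hq1 (hy_mem a ha.1)
      (by rw [hms a ha.1]; linarith [show |s a| ≤ 1 / 2 from ha.2]))
    (fun a ha b hb i => by
      have ha2 : |s a| ≤ 1 / 2 := ha.2
      have hb2 : |s b| ≤ 1 / 2 := hb.2
      have := abs_radialProj_sub_le (ε := 1 / 2) (by positivity) hqκ hq1 (hy_mem b hb.1)
        (by norm_num) (by rw [hms a ha.1]; linarith) (by rw [hms b hb.1]; linarith)
        (hy_lip a ha.1 b hb.1) i
      rw [div_div_eq_mul_div, div_one] at this
      linarith)
  -- Coning `g` towards `q` with parameter `|σ|` makes the depth exactly `|σ|`, as compatibility of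
  -- the hemispheres at the equator requires.
  set G : X → Fin (n + 2) → ℝ := fun x i => (1 - |σ x|) * g x i + |σ x| * q i with hG
  have hG_mem : ∀ x, G x ∈ stdSimplex ℝ (Fin (n + 2)) := fun x => by
    refine ⟨fun i => add_nonneg (mul_nonneg (by linarith [hσ1 x]) ((hg_mem x).1.1 i))
      (mul_nonneg (abs_nonneg _) (hq0 i).le), ?_⟩
    simp only [hG]
    rw [Finset.sum_add_distrib, ← Finset.mul_sum, ← Finset.mul_sum, hq1, (hg_mem x).1.2]
    ring
  have hG_min : ∀ x, minRatio q (G x) = |σ x| := fun x => by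
    obtain ⟨i, hi⟩ := (hg_mem x).2
    refine minRatio_eq_of_le hq0 (fun j => ?_) i (by simp [hG, hi])
    have := mul_nonneg (by linarith [hσ1 x] : 0 ≤ 1 - |σ x|) ((hg_mem x).1.1 j)
    simp only [hG]; linarith
  have hGA : ∀ a ∈ A, |s a| ≤ 1 / 2 → G a = y a := by
    intro a ha hsa
    ext i
    have h1 : (1 - |s a|) ≠ 0 := by linarith
    simp only [hG, hgA a ⟨ha, hsa⟩, hσA a ha, radialProj, hms a ha]
    field_simp; ring
  have hG_lip : ∀ x z i, |G x i - G z i| ≤ (2 * (N + 1) + Lg) * K * dist x z := by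
    intro x z i
    have := abs_lineMap_sub_lineMap_le (abs_nonneg (σ x)) (hσ1 x) (t' := |σ z|)
      (u := g x i) (v := q i)
      (abs_apply_le_one_of_mem_stdSimplex (hg_mem z).1 i)
      (abs_apply_le_one_of_mem_stdSimplex hqmem i)
    simp only [hG]
    refine this.trans ?_
    have h1 := hg_lip x z i
    have h2 := hσabs x z
    rw [sub_self, abs_zero]
    have h3 : D * ((1 + 2 * N) / (1 / 2) * (2 * K)) * dist x z = Lg * K * dist x z := by
      rw [hLg]; ring
    rw [h3] at h1
    linarith
  -- interpolation between the two extensions of the projection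
  set χ : X → ℝ := fun x => unitClamp (2 - 4 * |σ x|) with hχ
  have hχ_lip : ∀ x z, |χ x - χ z| ≤ 4 * ((N + 1) * K * dist x z) := fun x z => by
    refine (abs_unitClamp_sub_le _ _).trans ?_
    rw [show 2 - 4 * |σ x| - (2 - 4 * |σ z|) = -(4 * (|σ x| - |σ z|)) by ring, abs_neg, abs_mul,
      abs_of_pos (by norm_num : (0 : ℝ) < 4)]
    linarith [hσabs x z]
  set W : X → Fin (n + 2) → ℝ := fun x i => (1 - χ x) * Y x i + χ x * G x i with hW
  have hW_mem : ∀ x, W x ∈ stdSimplex ℝ (Fin (n + 2)) := fun x =>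
    (convex_stdSimplex ℝ (Fin (n + 2))) (hY_mem x) (hG_mem x)
      (by linarith [unitClamp_le_one (2 - 4 * |σ x|)]) (unitClamp_nonneg _) (by ring)
  have hW_lip : ∀ x z i, |W x i - W z i| ≤ L' * K * dist x z := by
    intro x z i
    have := abs_lineMap_sub_lineMap_le (unitClamp_nonneg (2 - 4 * |σ x|)) (unitClamp_le_one _)
      (t' := χ z) (u := Y x i) (v := G x i)
      (abs_apply_le_one_of_mem_stdSimplex (hY_mem z) i)
      (abs_apply_le_one_of_mem_stdSimplex (hG_mem z) i)
    simp only [hW]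
    refine this.trans ?_
    have h1 := hχ_lip x z
    have h2 := hY_lip x z i
    have h3 := hG_lip x z i
    rw [Fintype.card_fin, ← hN] at h2
    have h4 : |unitClamp (2 - 4 * |σ x|) - χ z| = |χ x - χ z| := rfl
    rw [h4, hL', hLy]
    linarith
  have hWA : ∀ a ∈ A, W a = y a := by
    intro a ha
    ext i
    by_cases hsa : |s a| ≤ 1 / 2
    · simp only [hW, hGA a ha hsa, hYA a ha]; ring
    · have : χ a = 0 := unitClamp_of_nonpos (by rw [hσA a ha]; linarith)
      simp only [hW, this, hYA a ha]; ring
  have hW_min : ∀ x, |σ x| ≤ 1 / 4 → minRatio q (W x) = |σ x| := by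
    intro x hx
    have : χ x = 1 := unitClamp_of_one_le (by linarith)
    rw [← hG_min x]
    congr 1
    ext i
    simp only [hW, this]; ring
  have hM_lip : ∀ x z, |minRatio q (W x) - minRatio q (W z)| ≤ N * L' * K * dist x z := by
    intro x z
    have := abs_minRatio_sub_le (by positivity) hqκ (hW_lip x z)
    rw [div_div_eq_mul_div, div_one] at this
    linarith
  have hM0 : ∀ x, 0 ≤ minRatio q (W x) := fun x => minRatio_nonneg hq0 (hW_mem x).1
  have hM1 : ∀ x, minRatio q (W x) ≤ 1 := fun x => minRatio_le_one hq0 hq1 (hW_mem x)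
  -- the coordinate of the apex
  set c : X → ℝ := fun x => if 0 ≤ σ x then minRatio q (W x) else 0 with hc
  have hc0 : ∀ x, 0 ≤ c x := fun x => by
    simp only [hc]; split_ifs; exacts [hM0 x, le_rfl]
  have hcM : ∀ x, c x ≤ minRatio q (W x) := fun x => by
    simp only [hc]; split_ifs; exacts [le_rfl, hM0 x]
  -- A sign change gives `|σ x| ≤ |σ x - σ z|`. Near the equator the depth of `W x` is `|σ x|`;
  -- elsewhere it is at most 1, hence at most `4 * |σ x|`.
  have hcross : ∀ x z, 0 ≤ σ x → σ z < 0 → minRatio q (W x) ≤ 4 * ((N + 1) * K * dist x z) := by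
    intro x z hx hz
    have h1 := (abs_le.1 (hσ_lip x z)).2
    rcases le_total (|σ x|) (1 / 4) with h | h
    · rw [hW_min x h]
      rw [abs_of_nonneg hx] at h ⊢
      linarith
    · rw [abs_of_nonneg hx] at h
      linarith [hM1 x]
  have hc_lip : ∀ x z, |c x - c z| ≤ (4 * (N + 1) + N * L') * K * dist x z := by
    intro x z
    have e1 : 0 ≤ (N + 1) * K * dist x z := by positivity
    have e2 : 0 ≤ N * L' * K * dist x z := (abs_nonneg _).trans (hM_lip x z)
    have e3 : (4 * (N + 1) + N * L') * K * dist x z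
      = 4 * ((N + 1) * K * dist x z) + N * L' * K * dist x z := by ring
    rw [e3]
    simp only [hc]
    split_ifs with hx hz hz
    · linarith [hM_lip x z]
    · rw [sub_zero, abs_of_nonneg (hM0 x)]
      linarith [hcross x z hx (not_le.1 hz)]
    · rw [zero_sub, abs_neg, abs_of_nonneg (hM0 z)]
      have := hcross z x hz (not_le.1 hx)
      rw [dist_comm] at this
      linarith
    · simp only [sub_self, abs_zero]; linarith
  -- This undoes the collapse: for `σ x ≥ 0`, removing the largest multiple of `q` kills a remaining
  -- coordinate; for `σ x < 0`, the apex coordinate is 0.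
  refine ⟨fun x => Fin.cons (c x) fun i => W x i - c x * q i, fun x => ⟨⟨fun i => ?_, ?_⟩, ?_⟩,
    fun x z i => ?_, fun a ha => ?_⟩
  · refine Fin.cases ?_ (fun j => ?_) i
    · simpa using hc0 x
    · have h1 := minRatio_mul_le hq0 (W x) j
      have h2 := mul_le_mul_of_nonneg_right (hcM x) (hq0 j).le
      simp only [Fin.cons_succ]
      linarith
  · rw [Fin.sum_univ_succ]
    simp only [Fin.cons_zero, Fin.cons_succ]
    rw [Finset.sum_sub_distrib, ← Finset.mul_sum, hq1, (hW_mem x).2]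
    ring
  · by_cases hx : 0 ≤ σ x
    · obtain ⟨i, hi⟩ := exists_eq_minRatio_mul hq0 (W x)
      exact ⟨i.succ, by simp [hc, hx, ← hi]⟩
    · exact ⟨0, by simp [hc, hx]⟩
  · have h0 := hc_lip x z
    have e : 0 ≤ L' * K * dist x z := (abs_nonneg _).trans (hW_lip x z 0)
    refine Fin.cases ?_ (fun j => ?_) i
    · simp only [Fin.cons_zero]
      linarith
    · simp only [Fin.cons_succ]
      have h1 := hW_lip x z j
      have h2 : W x j - c x * q j - (W z j - c z * q j)
        = (W x j - W z j) - (c x - c z) * q j := by ring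
      rw [h2]
      refine (abs_sub _ _).trans ?_
      rw [abs_mul, abs_of_pos (hq0 j)]
      have := mul_le_of_le_one_right (abs_nonneg (c x - c z)) (hqle j)
      linarith
  · have hca : c a = f a 0 := by
      simp only [hc, hσA a ha, hWA a ha, hmy]
      simp only [hs]
      have h0 := (hfA a ha).1.1 0
      rcases hzero a ha with h | h
      · split_ifs with hx
        · linarith [htl0 a ha]
        · exact h.symm
      · rw [h, sub_zero, if_pos h0, zero_add]
    ext i
    refine Fin.cases ?_ (fun j => ?_) i
    · simpa using hca
    · simp only [Fin.cons_succ, hWA a ha, hca, hy, htl]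
      ring

lemma BoundaryExtensor.mono {n k : ℕ} (hE : BoundaryExtensor (Fin (n + 2)) X) (h : n ≤ k) :
    BoundaryExtensor (Fin (k + 2)) X := by
  induction k, h using Nat.le_induction with
  | base => exact hE
  | succ k _ ih => exact ih.succ

/-- Among spaces of finite Nagata–Assouad dimension, those of which the `n`-sphere is a Lipschitz
extensor have dimension at most `n`. -/
lemma NagataDimLE.of_boundaryExtensor {m n : ℕ} (h : NagataDimLE X m)
    (hE : BoundaryExtensor (Fin (n + 2)) X) : NagataDimLE X n := by
  induction m with
  | zero => exact h.mono (Nat.zero_le n)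
  | succ m ih =>
    -- For `n ≤ m`, suspending up to the `m`-sphere allows the drop from `m + 1` to `m`.
    rcases lt_or_ge m n with hmn | hmn
    · exact h.mono hmn
    · exact ih (h.of_succ_of_boundaryExtensor (hE.mono hmn))

end Suspension

/-! ### A projection center in general position. -/

section GenericCenter

lemma continuous_minRatio {ι : Type*} [Fintype ι] [Nonempty ι] (q : ι → ℝ) :
    Continuous (minRatio q) := by
  have : minRatio q = fun y => Finset.univ.inf' Finset.univ_nonempty fun i => y i / q i := by
    ext y; rw [minRatio, Finset.inf'_univ_eq_ciInf]
  rw [this]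
  exact Continuous.finset_inf'_apply _ fun i _ => by fun_prop

/-- For a finite set `P` in `ℝ^{n+2}` there is a point near the middle of the standard simplex that
does not lie in the span of any `n + 1` points of `P`. -/
lemma exists_generic_mem_stdSimplex (n : ℕ) {P : Set (Fin (n + 2) → ℝ)} (hP : P.Finite) :
    ∃ q : Fin (n + 2) → ℝ, (∀ i, 1 / (2 * ((n + 2 : ℕ) : ℝ)) ≤ q i) ∧ ∑ i, q i = 1 ∧
      ∀ c : Fin (n + 1) → Fin (n + 2) → ℝ, (∀ i, c i ∈ P) →
        q ∉ Submodule.span ℝ (Set.range c) := by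
  have : Finite P := hP
  -- Spans of `n + 1` vectors in `ℝ^{n+2}` are proper subspaces, so this finite union is null and
  -- cannot contain an open cube.
  set B : Set (Fin (n + 2) → ℝ) :=
    ⋃ c : Fin (n + 1) → P, (Submodule.span ℝ (Set.range fun i => (c i : Fin (n + 2) → ℝ))) with hB
  have hnull : MeasureTheory.volume B = 0 := by
    refine MeasureTheory.measure_iUnion_null fun c => ?_
    refine MeasureTheory.Measure.addHaar_submodule _ _ fun htop => ?_
    have h1 := finrank_range_le_card (R := ℝ) fun i => (c i : Fin (n + 2) → ℝ)
    rw [Set.finrank, htop, finrank_top, Module.finrank_fin_fun, Fintype.card_fin] at h1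
    omega
  obtain ⟨u, hu, huB⟩ : ∃ u ∈ Set.univ.pi fun _ : Fin (n + 2) => Set.Ioo (1 : ℝ) 2, u ∉ B := by
    by_contra! hsub
    have hopen : IsOpen (Set.univ.pi fun _ : Fin (n + 2) => Set.Ioo (1 : ℝ) 2) :=
      isOpen_set_pi Set.finite_univ fun _ _ => isOpen_Ioo
    have hpos := hopen.measure_pos MeasureTheory.volume
      ⟨fun _ => 3 / 2, fun _ _ => by constructor <;> norm_num⟩
    exact hpos.ne' (MeasureTheory.measure_mono_null hsub hnull)
  have hu1 : ∀ i, 1 < u i := fun i => (hu i trivial).1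
  have hu2 : ∀ i, u i < 2 := fun i => (hu i trivial).2
  have hs0 : 0 < ∑ i, u i :=
    Finset.sum_pos (fun i _ => one_pos.trans (hu1 i)) Finset.univ_nonempty
  have hs2 : ∑ i, u i ≤ 2 * ((n + 2 : ℕ) : ℝ) :=
    (Finset.sum_le_sum fun i _ => (hu2 i).le).trans (by simp [mul_comm])
  refine ⟨(∑ i, u i)⁻¹ • u, fun i => ?_, ?_, fun c hc hq => huB ?_⟩
  · rw [Pi.smul_apply, smul_eq_mul, ← div_eq_inv_mul]
    exact div_le_div₀ (zero_le_one.trans (hu1 i).le) (hu1 i).le hs0 hs2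
  · simp only [Pi.smul_apply, smul_eq_mul]
    rw [← Finset.mul_sum, inv_mul_cancel₀ hs0.ne']
  · refine Set.mem_iUnion.2 ⟨fun i => ⟨c i, hc i⟩, ?_⟩
    have := Submodule.smul_mem _ (∑ i, u i) hq
    rwa [smul_inv_smul₀ hs0.ne'] at this

/-- The convex combinations of `n + 1` points of a finite set `P` stay away from a point outside
their spans. -/
lemma exists_minRatio_le_of_generic {n : ℕ} {P : Set (Fin (n + 2) → ℝ)} (hP : P.Finite)
    (hPΔ : P ⊆ stdSimplex ℝ (Fin (n + 2))) {q : Fin (n + 2) → ℝ} (hq : ∀ i, 0 < q i)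
    (hq1 : ∑ i, q i = 1)
    (hgen : ∀ c : Fin (n + 1) → Fin (n + 2) → ℝ, (∀ i, c i ∈ P) →
      q ∉ Submodule.span ℝ (Set.range c)) :
    ∃ ε : ℝ, 0 < ε ∧ ∀ c : Fin (n + 1) → Fin (n + 2) → ℝ, (∀ i, c i ∈ P) →
      ∀ w ∈ stdSimplex ℝ (Fin (n + 1)), minRatio q (∑ i, w i • c i) ≤ 1 - ε := by
  -- Weights and configurations form a compact set, so the depth attains its maximum; value 1 would
  -- put `q` in a forbidden span.
  set S : Set ((Fin (n + 1) → ℝ) × (Fin (n + 1) → Fin (n + 2) → ℝ)) :=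
    stdSimplex ℝ (Fin (n + 1)) ×ˢ Set.univ.pi fun _ => P with hS
  have hcomp : IsCompact S :=
    (isCompact_stdSimplex ℝ _).prod (isCompact_univ_pi fun _ => hP.isCompact)
  have hcont : Continuous fun z : (Fin (n + 1) → ℝ) × (Fin (n + 1) → Fin (n + 2) → ℝ) =>
      minRatio q (∑ i, z.1 i • z.2 i) :=
    (continuous_minRatio q).comp (by fun_prop)
  rcases S.eq_empty_or_nonempty with hE | hne
  · refine ⟨1, one_pos, fun c hc w hw => ?_⟩
    have : (w, c) ∈ S := ⟨hw, fun i _ => hc i⟩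
    simp [hE] at this
  obtain ⟨⟨w₀, c₀⟩, ⟨hw₀, hc₀⟩, hmax⟩ := hcomp.exists_isMaxOn hne hcont.continuousOn
  refine ⟨1 - minRatio q (∑ i, w₀ i • c₀ i), ?_, fun c hc w hw => ?_⟩
  · have hmem : ∑ i, w₀ i • c₀ i ∈ stdSimplex ℝ (Fin (n + 2)) :=
      (convex_stdSimplex ℝ _).sum_mem (fun i _ => hw₀.1 i) hw₀.2
        fun i _ => hPΔ (hc₀ i trivial)
    have := minRatio_lt_one hq hq1 hmem fun heq =>
      hgen c₀ (fun i => hc₀ i trivial) (heq ▸ Submodule.sum_mem _ fun i _ =>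
        Submodule.smul_mem _ _ (Submodule.subset_span ⟨i, rfl⟩))
    linarith
  · have h := isMaxOn_iff.1 hmax (w, c) ⟨hw, fun i _ => hc i⟩
    simp only at h
    linarith

end GenericCenter

/-! ### Extension from the dimension bound. -/

section Extension

variable {X : Type*} [MetricSpace X]

/-- The `n`-sphere is a Lipschitz extensor of every space of Nagata–Assouad dimension at most
`n`. -/
lemma NagataDimLE.boundaryExtensor {n : ℕ} (h : NagataDimLE X n) :
    BoundaryExtensor (Fin (n + 2)) X := by
  obtain ⟨C, hC1, H⟩ := h.exists_partition
  have hC0 : 0 < C := by linarith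
  set N : ℝ := ((n + 2 : ℕ) : ℝ) with hN
  have hN0 : 0 < N := by rw [hN]; positivity
  set κ : ℝ := 1 / (2 * N) with hκ
  have hκ0 : 0 < κ := by positivity
  -- An error of `2 * η` then changes `minRatio q` by at most `1 / 6`: points with depth below `2 /
  -- 3` keep depth below `5 / 6`, whence the cap `1 / 6` on `ε`.
  set η : ℝ := κ / 12 with hη
  have hη0 : 0 < η := by positivity
  obtain ⟨P, hPΔ, hP, hcover⟩ :=
    (isCompact_stdSimplex ℝ (Fin (n + 2))).finite_cover_balls hη0
  have hnet : ∀ y ∈ stdSimplex ℝ (Fin (n + 2)), ∃ p ∈ P, ∀ i, |p i - y i| ≤ η := by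
    intro y hy
    obtain ⟨p, hp, hyp⟩ := Set.mem_iUnion₂.1 (hcover hy)
    refine ⟨p, hp, fun i => ?_⟩
    rw [← Real.dist_eq]
    exact (dist_le_pi_dist p y i).trans (Metric.mem_ball'.1 hyp).le
  obtain ⟨q, hqκ, hq1, hgen⟩ := exists_generic_mem_stdSimplex n hP
  have hq0 : ∀ i, 0 < q i := fun i => hκ0.trans_le (hqκ i)
  obtain ⟨ε₀, hε₀, hε₀P⟩ := exists_minRatio_le_of_generic hP hPΔ hq0 hq1 hgen
  set ε : ℝ := min ε₀ (1 / 6) with hε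
  have hε_pos : 0 < ε := lt_min hε₀ (by norm_num)
  set M : ℝ := 2 * (3 * ((N + 2) / κ)) + (N + 2) + (n + 1) * C * ((N + 2) * C / η) with hM
  refine ⟨(1 + 2 / κ) / ε * M, by positivity, fun K hK A f hfA hf => ?_⟩
  -- The scale `r` is inversely proportional to `K`, so constant maps are treated apart.
  rcases hK.eq_or_lt with rfl | hKpos
  · rcases A.eq_empty_or_nonempty with rfl | ⟨a₀, ha₀⟩
    · obtain ⟨z, hz⟩ := simplexBoundary_nonempty n
      exact ⟨fun _ => z, fun _ => hz, fun x y i => by simp, fun a ha => ha.elim⟩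
    · refine ⟨fun _ => f a₀, fun _ => hfA a₀ ha₀, fun x y i => by simp, fun a ha => ?_⟩
      ext i
      have := hf a₀ ha₀ a ha i
      rw [zero_mul] at this
      exact sub_eq_zero.1 (abs_nonpos_iff.1 this)
  obtain ⟨F, hF_mem, hF_lip, hFA⟩ :=
    exists_lipschitz_extension_stdSimplex hK (fun a ha => (hfA a ha).1) hf
  rw [Fintype.card_fin, ← hN] at hF_lip
  -- approximation of `F` by a map with values in the union of finitely many `n`-simplices
  set r : ℝ := η / ((N + 2) * K * C) with hr
  have hr0 : 0 < r := by positivity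
  obtain ⟨w, b, hw, hw_lip, hwb, hb⟩ := H r hr0
  choose! net hnetP hnet_near using hnet
  set c : X → Fin (n + 1) → Fin (n + 2) → ℝ := fun x i => net (F (b i x)) with hc
  have hcP : ∀ x i, c x i ∈ P := fun x i => hnetP _ (hF_mem _)
  set E : X → Fin (n + 2) → ℝ := fun x => ∑ i, w x i • c x i with hE
  have hE_mem : ∀ x, E x ∈ stdSimplex ℝ (Fin (n + 2)) := fun x =>
    (convex_stdSimplex ℝ _).sum_mem (fun i _ => (hw x).1 i) (hw x).2 fun i _ => hPΔ (hcP x i)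
  have hE_apply : ∀ x j, E x j = ∑ i, w x i * c x i j := fun x j => by
    simp [hE, Finset.sum_apply]
  -- If both weights are positive, the labels and hence the net points agree; if one vanishes, the
  -- other weight is itself the difference.
  have hterm : ∀ x y i j, dist x y < r → |w x i * c x i j - w y i * c y i j|
      ≤ C / r * dist x y := by
    intro x y i j hxy
    refine le_trans ?_ (hw_lip x y i)
    have hcx := hPΔ (hcP x i)
    have hcy := hPΔ (hcP y i)
    rcases ((hw x).1 i).eq_or_lt with hx | hx
    · rw [← hx, zero_mul, zero_sub, zero_sub, abs_neg, abs_neg, abs_mul]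
      exact mul_le_of_le_one_right (abs_nonneg _) (abs_apply_le_one_of_mem_stdSimplex hcy j)
    rcases ((hw y).1 i).eq_or_lt with hy | hy
    · rw [← hy, zero_mul, sub_zero, sub_zero, abs_mul]
      exact mul_le_of_le_one_right (abs_nonneg _) (abs_apply_le_one_of_mem_stdSimplex hcx j)
    · have : c x i = c y i := by simp only [hc, hb i x y hx hy hxy]
      rw [this, ← sub_mul, abs_mul]
      exact mul_le_of_le_one_right (abs_nonneg _) (abs_apply_le_one_of_mem_stdSimplex hcy j)
  -- Beyond distance `r` the bound is trivial, coordinates in the simplex differing by at most 1.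
  have hE_lip : ∀ x y j, |E x j - E y j| ≤ (n + 1) * C / r * dist x y := by
    intro x y j
    rcases lt_or_ge (dist x y) r with hxy | hxy
    · rw [hE_apply, hE_apply, ← Finset.sum_sub_distrib]
      refine (Finset.abs_sum_le_sum_abs _ _).trans
        ((Finset.sum_le_sum fun i _ => hterm x y i j hxy).trans ?_)
      simp only [Finset.sum_const, Finset.card_univ, Fintype.card_fin, nsmul_eq_mul]
      push_cast
      exact le_of_eq (by ring)
    · refine (abs_apply_sub_le_one (hE_mem x) (hE_mem y) j).trans ?_
      rw [div_mul_eq_mul_div, one_le_div hr0]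
      have : (1 : ℝ) ≤ (n + 1) * C := by nlinarith [Nat.cast_nonneg (α := ℝ) n]
      nlinarith
  have hEF : ∀ x j, |E x j - F x j| ≤ 2 * η := by
    intro x j
    have h1 : E x j - F x j = ∑ i, w x i * (c x i j - F x j) := by
      simp only [mul_sub]
      rw [Finset.sum_sub_distrib, ← Finset.sum_mul, (hw x).2, one_mul, hE_apply]
    have h2 : ∀ i, |w x i * (c x i j - F x j)| ≤ w x i * (2 * η) := by
      intro i
      rw [abs_mul, abs_of_nonneg ((hw x).1 i)]
      rcases ((hw x).1 i).eq_or_lt with hx | hx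
      · simp [← hx]
      refine mul_le_mul_of_nonneg_left ?_ hx.le
      have h3 : |c x i j - F (b i x) j| ≤ η := hnet_near _ (hF_mem _) j
      -- The scale `r` is chosen so that `F` moves by at most `η` over distance `C * r`.
      have h4 : |F (b i x) j - F x j| ≤ η := by
        refine (hF_lip _ _ j).trans ?_
        rw [dist_comm]
        calc (N + 2) * K * dist x (b i x) ≤ (N + 2) * K * (C * r) := by
              gcongr; exact hwb i x hx
          _ = η := by rw [hr]; field_simp
      linarith [abs_sub_le (c x i j) (F (b i x) j) (F x j)]
    rw [h1]
    refine (Finset.abs_sum_le_sum_abs _ _).trans ((Finset.sum_le_sum fun i _ => h2 i).trans ?_)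
    rw [← Finset.sum_mul, (hw x).2, one_mul]
  -- interpolation between `F` and its approximation
  set t : X → ℝ := fun x => unitClamp (3 * minRatio q (F x) - 1) with ht
  have ht_lip : ∀ x y, |t x - t y| ≤ 3 * ((N + 2) / κ) * K * dist x y := by
    intro x y
    refine (abs_unitClamp_sub_le _ _).trans ?_
    have h1 := abs_minRatio_sub_le hκ0 hqκ (hF_lip x y)
    rw [sub_sub_sub_cancel_right, ← mul_sub, abs_mul, abs_of_pos (by norm_num : (0 : ℝ) < 3)]
    have h2 : (N + 2) * K * dist x y / κ = (N + 2) / κ * K * dist x y := by ring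
    rw [h2] at h1
    linarith
  set G : X → Fin (n + 2) → ℝ := fun x j => (1 - t x) * F x j + t x * E x j with hG
  have ht0 : ∀ x, 0 ≤ t x := fun x => unitClamp_nonneg _
  have ht1 : ∀ x, t x ≤ 1 := fun x => unitClamp_le_one _
  have hG_mem : ∀ x, G x ∈ stdSimplex ℝ (Fin (n + 2)) := fun x =>
    (convex_stdSimplex ℝ (Fin (n + 2))) (hF_mem x) (hE_mem x)
      (by linarith [ht1 x]) (ht0 x) (by ring)
  have hG_lip : ∀ x y j, |G x j - G y j| ≤ M * K * dist x y := by
    intro x y j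
    have := abs_lineMap_sub_lineMap_le (ht0 x) (ht1 x) (t' := t y) (u := F x j) (v := E x j)
      (abs_apply_le_one_of_mem_stdSimplex (hF_mem y) j)
      (abs_apply_le_one_of_mem_stdSimplex (hE_mem y) j)
    refine this.trans ?_
    have h1 := ht_lip x y
    have h2 := hF_lip x y j
    have h3 := hE_lip x y j
    have h4 : (n + 1) * C / r * dist x y
        = (n + 1) * C * ((N + 2) * C / η) * K * dist x y := by
      rw [hr]; field_simp
    rw [h4] at h3
    rw [hM]
    linarith
  have hG_min : ∀ x, ε ≤ 1 - minRatio q (G x) := by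
    intro x
    rcases le_or_gt 1 (3 * minRatio q (F x) - 1) with hx | hx
    · have h1 : G x = E x := by
        ext j
        simp only [hG, ht, unitClamp_of_one_le hx]; ring
      rw [h1]
      linarith [min_le_left ε₀ (1 / 6), hε₀P (c x) (hcP x) (w x) (hw x)]
    · have h1 : ∀ j, |G x j - F x j| ≤ 2 * η := fun j => by
        have : G x j - F x j = t x * (E x j - F x j) := by simp only [hG]; ring
        rw [this, abs_mul, abs_of_nonneg (ht0 x)]
        exact (mul_le_of_le_one_left (abs_nonneg _) (ht1 x)).trans (hEF x j)
      have h2 := minRatio_sub_le hκ0 hqκ h1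
      have h3 : 2 * η / κ = 1 / 6 := by rw [hη]; field_simp; norm_num
      linarith [min_le_right ε₀ (1 / 6)]
  refine ⟨fun x => radialProj q (G x), fun x => radialProj_mem hq0 hq1 (hG_mem x)
    (by linarith [hG_min x]), fun x y i => ?_, fun a ha => ?_⟩
  · have := abs_radialProj_sub_le hκ0 hqκ hq1 (hG_mem y) hε_pos (hG_min x) (hG_min y)
      (hG_lip x y) i
    linarith
  · have h1 : G a = f a := by
      ext j
      have : t a = 0 := unitClamp_of_nonpos (by rw [hFA a ha, minRatio_eq_zero hq0 (hfA a ha)]; simp)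
      simp only [hG, this, hFA a ha]; ring
    simp only [h1]
    exact radialProj_eq_self hq0 (hfA a ha)

end Extension

/-- Among metric spaces of finite Nagata–Assouad dimension, those of dimension at most `n` are
exactly those of which the `n`-sphere `∂Δ^{n+1}` (with the `ℓ_1` or the `ℓ_2` metric) is a
Lipschitz extensor. -/
theorem mainTheorem1 {X : Type*} [MetricSpace X]
    (hX : ∃ m : ℕ, NagataDimLE X m) (n : ℕ)
    (p : ℝ≥0∞) [Fact (1 ≤ p)] (hp : p = 1 ∨ p = 2) :
    IsLipschitzExtensor (simplexSphere p n) X ↔ NagataDimLE X n := by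
  obtain ⟨m, hm⟩ := hX
  rw [isLipschitzExtensor_simplexSphere_iff]
  exact ⟨hm.of_boundaryExtensor, NagataDimLE.boundaryExtensor⟩
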